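/- For $a,b>0$ let $\gamma_{a,b}(x)=\frac{2b}{\pi}\arcsin\big(\big[\cos\frac{\pi x}{2a}\big]^{(a/b)^2}\big)$ for $|x|<a$, let $$\Omega_{a,b}=\{(x_1,x_2)\in\mathbb R^2:\ -a<x_1<a,\ |x_2|<\gamma_{a,b}(x_1)\},\qquad \psi_{a,b}(x_1,x_2)=2\sin\Big(\frac{\pi x_1}{2a}\Big)\cos\Big(\frac{\pi x_2}{2b}\Big).$$ Let $\Delta_{a,b}$ be the Neumann Laplacian on $\Omega_{a,b}$, that is, the non-negative self-adjoint operator of the quadratic form $\int_{\Omega_{a,b}}|\nabla\psi|^2\,dx$ with form domain $H^1(\Omega_{a,b})$. We say that $\Omega_{a,b}$ has the ground state property if $\Delta_{a,b}$ has a smallest positive eigenvalue, this eigenvalue is simple, and its normalized real eigenfunction is, up to sign, $\psi_{a,b}/\|\psi_{a,b}\|_{L^2(\Omega_{a,b})}$. A threshold for $a>0$ is a number $t\in(0,a]$ such that $\Omega_{a,b}$ has the ground state property for every $0<b<t$. If thresholds for $a$ exist, then there is a largest one, denoted by $b_a$; if there is none, put $b_a=0$. Let $a,\tilde a>0$. Then: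 1. if $b,\tilde b>0$ and $a/b=\tilde a/\tilde b$, then $\Omega_{a,b}$ has the ground state property if and only if $\Omega_{\tilde a,\tilde b}$ has it; 2. a real number $t$ is a threshold for $a$ if and only if $\frac{\tilde a}{a}t$ is a threshold for $\tilde a$, and $t$ is the largest threshold for $a$ if and only if $\frac{\tilde a}{a}t$ is the largest threshold for $\tilde a$; 3. $b_{\tilde a}=\frac{\tilde a}{a}\,b_a$. -/

import Mathlib

open MeasureTheory Real
open scoped ContDiff

noncomputable section

namespace NeumannDomain

/-- A smooth real function on the plane with compact support inside `Ω`. -/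
def IsTestFunction (Ω : Set (ℝ × ℝ)) (φ : ℝ × ℝ → ℝ) : Prop :=
  ContDiff ℝ ∞ φ ∧ HasCompactSupport φ ∧ tsupport φ ⊆ Ω

/-- `u` is in `H¹(Ω)` with weak gradient `g`: `u`, `g₁`, `g₂` are in `L²(Ω)`, and
`∫_Ω u ∂ᵢφ = - ∫_Ω gᵢ φ` for `i = 1, 2` and every test function `φ` on `Ω`. -/
structure HasH1Gradient (Ω : Set (ℝ × ℝ)) (u : ℝ × ℝ → ℝ) (g : ℝ × ℝ → ℝ × ℝ) : Prop where
  memLp : MemLp u 2 (volume.restrict Ω)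
  memLp_fst : MemLp (fun x => (g x).1) 2 (volume.restrict Ω)
  memLp_snd : MemLp (fun x => (g x).2) 2 (volume.restrict Ω)
  weak_fst : ∀ φ, IsTestFunction Ω φ →
    ∫ x in Ω, u x * fderiv ℝ φ x (1, 0) = - ∫ x in Ω, (g x).1 * φ x
  weak_snd : ∀ φ, IsTestFunction Ω φ →
    ∫ x in Ω, u x * fderiv ℝ φ x (0, 1) = - ∫ x in Ω, (g x).2 * φ x

/-- `u` is in the domain of the Neumann Laplacian on `Ω`, the self-adjoint operator of the
quadratic form `∫_Ω |∇u|²` with form domain `H¹(Ω)`, and `-Δ u = lam u` (`u = 0` allowed). -/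
def InEigenspace (Ω : Set (ℝ × ℝ)) (lam : ℝ) (u : ℝ × ℝ → ℝ) : Prop :=
  ∃ g, HasH1Gradient Ω u g ∧
    ∀ v h, HasH1Gradient Ω v h →
      ∫ x in Ω, ((g x).1 * (h x).1 + (g x).2 * (h x).2) = lam * ∫ x in Ω, u x * v x

/-- `lam` is an eigenvalue of the Neumann Laplacian on `Ω`. -/
def IsEigenvalue (Ω : Set (ℝ × ℝ)) (lam : ℝ) : Prop :=
  ∃ u, InEigenspace Ω lam u ∧ ¬ (u =ᵐ[volume.restrict Ω] 0)

/-- The norm of `L²(Ω)`. -/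
def l2Norm (Ω : Set (ℝ × ℝ)) (u : ℝ × ℝ → ℝ) : ℝ := √(∫ x in Ω, u x ^ 2)

/-- `ψ` is a ground state of the Neumann Laplacian on `Ω`: there is a smallest positive
eigenvalue, it is simple, and `ψ` is a normalized eigenfunction for it. -/
def IsGroundState (Ω : Set (ℝ × ℝ)) (ψ : ℝ × ℝ → ℝ) : Prop :=
  ∃ lam, IsLeast {l : ℝ | 0 < l ∧ IsEigenvalue Ω l} lam ∧
    InEigenspace Ω lam ψ ∧ l2Norm Ω ψ = 1 ∧
    ∀ u, InEigenspace Ω lam u → ∃ c : ℝ, u =ᵐ[volume.restrict Ω] fun x => c * ψ x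

/-- The upper boundary curve `γ_{a,b}` of the star-like Neumann domain. -/
def boundaryCurve (a b x : ℝ) : ℝ :=
  2 * b / π * arcsin (cos (π / (2 * a) * x) ^ ((a / b) ^ 2))

/-- The star-like Neumann domain `Ω_{a,b}`, centred at the origin. -/
def starDomain (a b : ℝ) : Set (ℝ × ℝ) :=
  {x | |x.2| < boundaryCurve a b x.1 ∧ -a < x.1 ∧ x.1 < a}

/-- The eigenfunction `ψ_{a,b}`. -/
def starFunction (a b : ℝ) (x : ℝ × ℝ) : ℝ :=
  2 * sin (π / (2 * a) * x.1) * cos (π / (2 * b) * x.2)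

/-- `Ω_{a,b}` has the ground state property: the ground state exists and is, up to sign, the
normalized restriction of `ψ_{a,b}`. -/
def GroundStateProperty (a b : ℝ) : Prop :=
  ∃ ψ, IsGroundState (starDomain a b) ψ ∧
    ((ψ =ᵐ[volume.restrict (starDomain a b)]
        fun x => (l2Norm (starDomain a b) (starFunction a b))⁻¹ * starFunction a b x) ∨
      (ψ =ᵐ[volume.restrict (starDomain a b)]
        fun x => -((l2Norm (starDomain a b) (starFunction a b))⁻¹ * starFunction a b x)))

/-- `t` is a threshold for `a`: `Ω_{a,b}` has the ground state property for all `0 < b < t`.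
As the domains `Ω_{a,b}` are star-like only for `b < a`, thresholds lie in `(0, a]`. -/
def IsThreshold (a t : ℝ) : Prop :=
  0 < t ∧ t ≤ a ∧ ∀ b, 0 < b → b < t → GroundStateProperty a b

/-- The largest threshold `b_a` for `a` (see `isGreatest_threshold`). -/
def threshold (a : ℝ) : ℝ := sSup {t | IsThreshold a t}

theorem isGreatest_threshold {a : ℝ} (h : ∃ t, IsThreshold a t) :
    IsGreatest {t | IsThreshold a t} (threshold a) := by
  obtain ⟨t, ht⟩ := h
  have hbdd : BddAbove {t | IsThreshold a t} := ⟨a, fun s hs => hs.2.1⟩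
  refine ⟨⟨lt_of_lt_of_le ht.1 (le_csSup hbdd ht), csSup_le ⟨t, ht⟩ fun s hs => hs.2.1, ?_⟩,
    fun s hs => le_csSup hbdd hs⟩
  intro b hb hbt
  obtain ⟨s, hs, hbs⟩ := exists_lt_of_lt_csSup ⟨t, ht⟩ hbt
  exact hs.2.2 b hb hbs

end NeumannDomain

end

/-!
The dilation `x ↦ k • x` maps `Ω_{a,b}` onto `Ω_{ka,kb}` and pulls `ψ_{ka,kb}` back to `ψ_{a,b}`.
It also carries `H¹` to `H¹`: the pull-back of a function with weak gradient `g` has the weak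
gradient `k • g (k • x)` (`HasH1Gradient.comp_smul`), and since areas are multiplied by `k²`, weak
solutions of `-Δ u = lam u` pull back to weak solutions of `-Δ v = k² lam v`
(`InEigenspace.comp_smul`). Because `lam ↦ k² lam` is an increasing bijection of the positive
half-line, the smallest positive eigenvalue, its simplicity and, after multiplication by `k`, the
normalized ground state are preserved (`IsGroundState.comp_smul`). Hence the ground state property
is invariant under dilations; it depends only on `a / b`, and thresholds scale linearly with `a`.
-/

open MeasureTheory Real
open scoped ContDiff Pointwise

namespace NeumannDomain

/-! ### Dilations and Lebesgue measure in the plane -/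

theorem measurableEmbedding_smul {k : ℝ} (hk : 0 < k) :
    MeasurableEmbedding (fun x : ℝ × ℝ => k • x) :=
  (Homeomorph.smulOfNeZero k hk.ne').measurableEmbedding

theorem map_smul_restrict {k : ℝ} (hk : 0 < k) (Ω : Set (ℝ × ℝ)) :
    Measure.map (fun x : ℝ × ℝ => k • x)
        ((volume : Measure (ℝ × ℝ)).restrict ((fun x => k • x) ⁻¹' Ω)) =
      ENNReal.ofReal (k ^ 2)⁻¹ • (volume : Measure (ℝ × ℝ)).restrict Ω := by
  rw [← (measurableEmbedding_smul hk).restrict_map, Measure.map_addHaar_smul _ hk.ne',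
    Measure.restrict_smul]
  simp [abs_of_pos hk]

theorem setIntegral_preimage_smul {k : ℝ} (hk : 0 < k) (Ω : Set (ℝ × ℝ)) (f : ℝ × ℝ → ℝ) :
    ∫ x in (fun x : ℝ × ℝ => k • x) ⁻¹' Ω, f (k • x) = (k ^ 2)⁻¹ * ∫ x in Ω, f x := by
  rw [← (measurableEmbedding_smul hk).integral_map, map_smul_restrict hk, integral_smul_measure,
    ENNReal.toReal_ofReal (by positivity), smul_eq_mul]

theorem memLp_comp_smul {k : ℝ} (hk : 0 < k) {Ω : Set (ℝ × ℝ)} {u : ℝ × ℝ → ℝ}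
    (hu : MemLp u 2 (volume.restrict Ω)) :
    MemLp (fun x => u (k • x)) 2 (volume.restrict ((fun x : ℝ × ℝ => k • x) ⁻¹' Ω)) := by
  have h := hu.smul_measure (c := ENNReal.ofReal (k ^ 2)⁻¹) ENNReal.ofReal_ne_top
  rw [← map_smul_restrict hk, (measurableEmbedding_smul hk).memLp_map_measure_iff] at h
  exact h

theorem ae_comp_smul {k : ℝ} (hk : 0 < k) {Ω : Set (ℝ × ℝ)} {u v : ℝ × ℝ → ℝ}
    (h : u =ᵐ[volume.restrict Ω] v) :
    (fun x => u (k • x)) =ᵐ[volume.restrict ((fun x : ℝ × ℝ => k • x) ⁻¹' Ω)]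
      fun x => v (k • x) := by
  have h' : u =ᵐ[ENNReal.ofReal (k ^ 2)⁻¹ • volume.restrict Ω] v :=
    Measure.ae_smul_measure h _
  rw [← map_smul_restrict hk] at h'
  exact ae_of_ae_map (measurableEmbedding_smul hk).measurable.aemeasurable h'

theorem preimage_inv_smul_preimage_smul {k : ℝ} (hk : 0 < k) (Ω : Set (ℝ × ℝ)) :
    (fun x : ℝ × ℝ => k⁻¹ • x) ⁻¹' ((fun x => k • x) ⁻¹' Ω) = Ω := by
  ext x
  simp only [Set.mem_preimage, smul_inv_smul₀ hk.ne']

/-! ### Dilations of Sobolev functions and eigenfunctions -/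

theorem IsTestFunction.comp_inv_smul {k : ℝ} (hk : 0 < k) {Ω : Set (ℝ × ℝ)} {φ : ℝ × ℝ → ℝ}
    (h : IsTestFunction ((fun x => k • x) ⁻¹' Ω) φ) :
    IsTestFunction Ω (fun x => φ (k⁻¹ • x)) := by
  have hcont : Continuous (fun x : ℝ × ℝ => k⁻¹ • x) := continuous_const_smul _
  refine ⟨h.1.comp (contDiff_const_smul _),
    h.2.1.comp_homeomorph (Homeomorph.smulOfNeZero k⁻¹ (inv_ne_zero hk.ne')), fun x hx => ?_⟩
  have := h.2.2 (tsupport_comp_subset_preimage φ hcont hx)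
  simpa [Set.mem_preimage, smul_inv_smul₀ hk.ne'] using this

theorem fderiv_comp_inv_smul {k : ℝ} (hk : 0 < k) {φ : ℝ × ℝ → ℝ} (e x : ℝ × ℝ) :
    fderiv ℝ φ x e = k * fderiv ℝ (fun y => φ (k⁻¹ • y)) (k • x) e := by
  rw [fderiv_comp_smul, inv_smul_smul₀ hk.ne', smul_apply, smul_eq_mul,
    mul_inv_cancel_left₀ hk.ne']

/-- Integration by parts in a direction `e` is carried over by a dilation, the weak derivative
being multiplied by the dilation factor. -/
theorem weakDeriv_comp_smul {k : ℝ} (hk : 0 < k) {Ω : Set (ℝ × ℝ)} {u g : ℝ × ℝ → ℝ} {e : ℝ × ℝ}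
    (h : ∀ φ, IsTestFunction Ω φ →
      ∫ x in Ω, u x * fderiv ℝ φ x e = - ∫ x in Ω, g x * φ x)
    {φ : ℝ × ℝ → ℝ} (hφ : IsTestFunction ((fun x => k • x) ⁻¹' Ω) φ) :
    ∫ x in (fun x : ℝ × ℝ => k • x) ⁻¹' Ω, u (k • x) * fderiv ℝ φ x e =
      - ∫ x in (fun x : ℝ × ℝ => k • x) ⁻¹' Ω, k * g (k • x) * φ x := by
  have h1 := setIntegral_preimage_smul hk Ω
    (fun y => k * (u y * fderiv ℝ (fun z => φ (k⁻¹ • z)) y e))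
  have h2 := setIntegral_preimage_smul hk Ω (fun y => k * (g y * φ (k⁻¹ • y)))
  rw [integral_const_mul (μ := volume.restrict Ω), h _ (hφ.comp_inv_smul hk)] at h1
  rw [integral_const_mul (μ := volume.restrict Ω)] at h2
  simp only [inv_smul_smul₀ hk.ne'] at h2
  calc _ = _ := by
        congr 1; ext x; rw [fderiv_comp_inv_smul hk e x]; ring
    _ = _ := h1
    _ = - ∫ x in (fun x : ℝ × ℝ => k • x) ⁻¹' Ω, k * (g (k • x) * φ x) := by rw [h2]; ring
    _ = _ := by simp only [mul_assoc]

theorem HasH1Gradient.comp_smul {k : ℝ} (hk : 0 < k) {Ω : Set (ℝ × ℝ)} {u : ℝ × ℝ → ℝ}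
    {g : ℝ × ℝ → ℝ × ℝ} (h : HasH1Gradient Ω u g) :
    HasH1Gradient ((fun x => k • x) ⁻¹' Ω) (fun x => u (k • x)) (fun x => k • g (k • x)) where
  memLp := memLp_comp_smul hk h.memLp
  memLp_fst := (memLp_comp_smul hk h.memLp_fst).const_mul k
  memLp_snd := (memLp_comp_smul hk h.memLp_snd).const_mul k
  weak_fst _ hφ := weakDeriv_comp_smul (g := fun x => (g x).1) hk h.weak_fst hφ
  weak_snd _ hφ := weakDeriv_comp_smul (g := fun x => (g x).2) hk h.weak_snd hφ

theorem InEigenspace.comp_smul {k : ℝ} (hk : 0 < k) {Ω : Set (ℝ × ℝ)} {lam : ℝ} {u : ℝ × ℝ → ℝ}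
    (h : InEigenspace Ω lam u) :
    InEigenspace ((fun x => k • x) ⁻¹' Ω) (k ^ 2 * lam) (fun x => u (k • x)) := by
  obtain ⟨g, hg, hweak⟩ := h
  refine ⟨_, hg.comp_smul hk, fun v w hv => ?_⟩
  -- Test the equation on `Ω` against the function that pulls back to `v`.
  have hv' := hv.comp_smul (inv_pos.2 hk)
  rw [preimage_inv_smul_preimage_smul hk] at hv'
  have h0 := hweak _ _ hv'
  have h1 := setIntegral_preimage_smul hk Ω (fun y => k ^ 2 *
    ((g y).1 * (k⁻¹ • w (k⁻¹ • y)).1 + (g y).2 * (k⁻¹ • w (k⁻¹ • y)).2))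
  have h2 := setIntegral_preimage_smul hk Ω (fun y => u y * v (k⁻¹ • y))
  rw [integral_const_mul (μ := volume.restrict Ω), h0] at h1
  simp only [inv_smul_smul₀ hk.ne'] at h1 h2
  rw [h2]
  calc _ = _ := by
        congr 1; ext x
        simp only [Prod.smul_fst, Prod.smul_snd, smul_eq_mul]
        field_simp
    _ = _ := h1
    _ = _ := by ring

/-- A function on the dilated domain solves an eigenvalue equation if its pull-back does. -/
theorem InEigenspace.of_preimage_smul {k : ℝ} (hk : 0 < k) {Ω : Set (ℝ × ℝ)} {lam : ℝ}
    {u : ℝ × ℝ → ℝ} (h : InEigenspace ((fun x => k • x) ⁻¹' Ω) lam u) :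
    InEigenspace Ω ((k ^ 2)⁻¹ * lam) (fun x => u (k⁻¹ • x)) := by
  have := h.comp_smul (inv_pos.2 hk)
  rwa [preimage_inv_smul_preimage_smul hk, inv_pow] at this

theorem InEigenspace.const_mul {Ω : Set (ℝ × ℝ)} {lam : ℝ} {u : ℝ × ℝ → ℝ}
    (h : InEigenspace Ω lam u) (c : ℝ) : InEigenspace Ω lam (fun x => c * u x) := by
  obtain ⟨g, hg, hweak⟩ := h
  refine ⟨fun x => c • g x, ⟨hg.memLp.const_mul c, hg.memLp_fst.const_mul c,
    hg.memLp_snd.const_mul c, fun φ hφ => ?_, fun φ hφ => ?_⟩, fun v w hv => ?_⟩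
  · simp only [Prod.smul_fst, smul_eq_mul, mul_assoc, integral_const_mul, hg.weak_fst φ hφ,
      mul_neg]
  · simp only [Prod.smul_snd, smul_eq_mul, mul_assoc, integral_const_mul, hg.weak_snd φ hφ,
      mul_neg]
  · simp only [Prod.smul_fst, Prod.smul_snd, smul_eq_mul, mul_assoc, ← mul_add,
      integral_const_mul, hweak v w hv]
    ring

theorem IsEigenvalue.preimage_smul {k : ℝ} (hk : 0 < k) {Ω : Set (ℝ × ℝ)} {lam : ℝ}
    (h : IsEigenvalue Ω lam) : IsEigenvalue ((fun x => k • x) ⁻¹' Ω) (k ^ 2 * lam) := by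
  obtain ⟨u, hu, hne⟩ := h
  refine ⟨_, hu.comp_smul hk, fun h0 => hne ?_⟩
  have h1 := ae_comp_smul (inv_pos.2 hk) (v := fun _ => 0) h0
  simp only [preimage_inv_smul_preimage_smul hk, smul_inv_smul₀ hk.ne'] at h1
  exact h1

theorem IsEigenvalue.of_preimage_smul {k : ℝ} (hk : 0 < k) {Ω : Set (ℝ × ℝ)} {lam : ℝ}
    (h : IsEigenvalue ((fun x => k • x) ⁻¹' Ω) lam) : IsEigenvalue Ω ((k ^ 2)⁻¹ * lam) := by
  have := h.preimage_smul (inv_pos.2 hk)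
  rwa [preimage_inv_smul_preimage_smul hk, inv_pow] at this

/-! ### Dilations of ground states -/

theorem l2Norm_comp_smul {k : ℝ} (hk : 0 < k) (Ω : Set (ℝ × ℝ)) (u : ℝ × ℝ → ℝ) :
    l2Norm ((fun x => k • x) ⁻¹' Ω) (fun x => u (k • x)) = k⁻¹ * l2Norm Ω u := by
  rw [l2Norm, l2Norm, setIntegral_preimage_smul hk Ω (fun x => u x ^ 2),
    Real.sqrt_mul (by positivity), ← inv_pow, Real.sqrt_sq (inv_pos.2 hk).le]

theorem l2Norm_const_mul {k : ℝ} (hk : 0 < k) (Ω : Set (ℝ × ℝ)) (u : ℝ × ℝ → ℝ) :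
    l2Norm Ω (fun x => k * u x) = k * l2Norm Ω u := by
  simp only [l2Norm, mul_pow, integral_const_mul]
  rw [Real.sqrt_mul (by positivity), Real.sqrt_sq hk.le]

/-- The factor `k` restores the normalization. -/
theorem IsGroundState.comp_smul {k : ℝ} (hk : 0 < k) {Ω : Set (ℝ × ℝ)} {ψ : ℝ × ℝ → ℝ}
    (h : IsGroundState Ω ψ) :
    IsGroundState ((fun x => k • x) ⁻¹' Ω) (fun x => k * ψ (k • x)) := by
  obtain ⟨lam, ⟨⟨hpos, hev⟩, hleast⟩, hψ, hnorm, hsimple⟩ := h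
  refine ⟨k ^ 2 * lam, ⟨⟨by positivity, hev.preimage_smul hk⟩, fun l hl => ?_⟩,
    (hψ.comp_smul hk).const_mul k, ?_, fun u hu => ?_⟩
  · have hle := hleast ⟨mul_pos (by positivity) hl.1, hl.2.of_preimage_smul hk⟩
    rwa [inv_mul_eq_div, le_div_iff₀' (by positivity)] at hle
  · rw [l2Norm_const_mul hk _ (fun x => ψ (k • x)), l2Norm_comp_smul hk, hnorm, mul_one,
      mul_inv_cancel₀ hk.ne']
  · have hu' := hu.of_preimage_smul hk
    rw [inv_mul_cancel_left₀ (by positivity)] at hu'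
    obtain ⟨c, hc⟩ := hsimple _ hu'
    have hc' := ae_comp_smul hk hc
    simp only [inv_smul_smul₀ hk.ne'] at hc'
    refine ⟨c * k⁻¹, hc'.trans (Filter.Eventually.of_forall fun x => ?_)⟩
    simp only
    field_simp

/-! ### The star-like domains -/

theorem pi_div_mul_mul {k : ℝ} (hk : 0 < k) (c y : ℝ) :
    π / (2 * (k * c)) * (k * y) = π / (2 * c) * y := by
  rw [mul_left_comm 2 k c, div_mul_eq_mul_div, div_mul_eq_mul_div, mul_left_comm π k y,
    mul_div_mul_left _ _ hk.ne']

theorem boundaryCurve_mul {k : ℝ} (hk : 0 < k) (a b x : ℝ) :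
    boundaryCurve (k * a) (k * b) (k * x) = k * boundaryCurve a b x := by
  rw [boundaryCurve, boundaryCurve, pi_div_mul_mul hk, mul_div_mul_left _ _ hk.ne']
  ring

theorem preimage_smul_starDomain {k : ℝ} (hk : 0 < k) (a b : ℝ) :
    (fun x : ℝ × ℝ => k • x) ⁻¹' starDomain (k * a) (k * b) = starDomain a b := by
  ext x
  simp only [starDomain, Set.mem_preimage, Set.mem_ofPred_eq, Prod.smul_fst, Prod.smul_snd,
    smul_eq_mul, boundaryCurve_mul hk, abs_mul, abs_of_pos hk, ← mul_neg,
    mul_lt_mul_iff_right₀ hk]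

theorem starFunction_smul {k : ℝ} (hk : 0 < k) (a b : ℝ) (x : ℝ × ℝ) :
    starFunction (k * a) (k * b) (k • x) = starFunction a b x := by
  simp only [starFunction, Prod.smul_fst, Prod.smul_snd, smul_eq_mul,
    pi_div_mul_mul hk]

theorem GroundStateProperty.of_mul {k : ℝ} (hk : 0 < k) {a b : ℝ}
    (h : GroundStateProperty (k * a) (k * b)) : GroundStateProperty a b := by
  obtain ⟨ψ, hψ, hor⟩ := h
  have hg := hψ.comp_smul hk
  have hn := l2Norm_comp_smul hk (starDomain (k * a) (k * b)) (starFunction (k * a) (k * b))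
  simp only [starFunction_smul hk, preimage_smul_starDomain hk] at hg hn
  refine ⟨_, hg, ?_⟩
  have hn' : (l2Norm (starDomain a b) (starFunction a b))⁻¹ =
      k * (l2Norm (starDomain (k * a) (k * b)) (starFunction (k * a) (k * b)))⁻¹ := by
    rw [show l2Norm (starDomain a b) (starFunction a b) = _ from hn, mul_inv, inv_inv]
  rw [hn']
  refine hor.imp (fun h => ?_) (fun h => ?_)
  all_goals
    have h' := ae_comp_smul hk h
    simp only [starFunction_smul hk, preimage_smul_starDomain hk] at h'
    filter_upwards [h'] with x hx
    rw [hx]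
    ring

theorem groundStateProperty_mul_iff {k : ℝ} (hk : 0 < k) {a b : ℝ} :
    GroundStateProperty (k * a) (k * b) ↔ GroundStateProperty a b := by
  refine ⟨.of_mul hk, fun h => .of_mul (inv_pos.2 hk) ?_⟩
  rwa [inv_mul_cancel_left₀ hk.ne', inv_mul_cancel_left₀ hk.ne']

theorem isThreshold_mul_iff {k : ℝ} (hk : 0 < k) {a t : ℝ} :
    IsThreshold (k * a) (k * t) ↔ IsThreshold a t := by
  refine and_congr (mul_pos_iff_of_pos_left hk) (and_congr (mul_le_mul_iff_right₀ hk) ?_)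
  refine ⟨fun h b hb hbt => ?_, fun h b hb hbt => ?_⟩
  · exact (h (k * b) (by positivity) (by gcongr)).of_mul hk
  · obtain ⟨c, rfl⟩ : ∃ c, b = k * c := ⟨k⁻¹ * b, (mul_inv_cancel_left₀ hk.ne' b).symm⟩
    exact (groundStateProperty_mul_iff hk).2
      (h c (pos_of_mul_pos_right hb hk.le) (lt_of_mul_lt_mul_left hbt hk.le))

theorem setOf_isThreshold_mul {k : ℝ} (hk : 0 < k) (a : ℝ) :
    {s | IsThreshold (k * a) s} = k • {s | IsThreshold a s} := by
  ext s
  rw [Set.mem_smul_set_iff_inv_smul_mem₀ hk.ne', Set.mem_ofPred_eq, Set.mem_ofPred_eq,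
    ← isThreshold_mul_iff hk (a := a), smul_eq_mul, mul_inv_cancel_left₀ hk.ne']

theorem isGreatest_threshold_mul_iff {k : ℝ} (hk : 0 < k) {a t : ℝ} :
    IsGreatest {s | IsThreshold (k * a) s} (k * t) ↔ IsGreatest {s | IsThreshold a s} t := by
  rw [setOf_isThreshold_mul hk, ← smul_eq_mul, IsGreatest, IsGreatest,
    upperBounds_smul_of_pos hk,
    Set.smul_mem_smul_set_iff₀ hk.ne', Set.smul_mem_smul_set_iff₀ hk.ne']

/-- This includes the case without thresholds, where both suprema are `sSup ∅ = 0`. -/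
theorem threshold_mul {k : ℝ} (hk : 0 < k) (a : ℝ) :
    threshold (k * a) = k * threshold a := by
  rw [threshold, setOf_isThreshold_mul hk, Real.sSup_smul_of_nonneg hk.le, smul_eq_mul, threshold]

end NeumannDomain

theorem mainTheorem7 (a a' : ℝ) (ha : 0 < a) (ha' : 0 < a') :
    (∀ b b' : ℝ, 0 < b → 0 < b' → a / b = a' / b' →
      (NeumannDomain.GroundStateProperty a b ↔ NeumannDomain.GroundStateProperty a' b')) ∧
    (∀ t : ℝ, NeumannDomain.IsThreshold a t ↔ NeumannDomain.IsThreshold a' (a' / a * t)) ∧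
    (∀ t : ℝ, IsGreatest {s | NeumannDomain.IsThreshold a s} t ↔
      IsGreatest {s | NeumannDomain.IsThreshold a' s} (a' / a * t)) ∧
    NeumannDomain.threshold a' = a' / a * NeumannDomain.threshold a := by
  obtain ⟨k, rfl⟩ : ∃ k, a' = k * a := ⟨a' / a, (div_mul_cancel₀ a' ha.ne').symm⟩
  have hk : 0 < k := pos_of_mul_pos_left ha' ha.le
  rw [mul_div_cancel_right₀ k ha.ne']
  refine ⟨fun b b' hb hb' hab => ?_, fun t => (NeumannDomain.isThreshold_mul_iff hk).symm,
    fun t => (NeumannDomain.isGreatest_threshold_mul_iff hk).symm,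
    NeumannDomain.threshold_mul hk a⟩
  obtain rfl : b' = k * b := by
    rw [div_eq_div_iff hb.ne' hb'.ne'] at hab
    exact mul_left_cancel₀ ha.ne' (by rw [hab]; ring)
  exact (NeumannDomain.groundStateProperty_mul_iff hk).symm
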